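/- Let $X\subseteq\mathbb{R}^d$ be compact with its Borel $\sigma$-algebra, and let $\mathcal{H}_k$ be a reproducing kernel Hilbert space of real functions on $X$ whose kernel $k:X\times X\to\mathbb{R}$ is measurable and bounded above by a constant $K$. Let $\phi:X\to\mathcal{H}_k$ satisfy $k(x,y)=\langle\phi(x),\phi(y)\rangle_{\mathcal{H}_k}$ and let $c(x,y)=\|\phi(x)-\phi(y)\|_{\mathcal{H}_k}$. Let $\mathcal{P}(X)$ be the set of Borel probability measures on $X$, with the $\sigma$-algebra generated by the maps $\rho\mapsto\rho(A)$. For $\rho,\varrho\in\mathcal{P}(X)$ put $$\mathcal{W}_1(\rho,\varrho)=\inf_{\gamma\in\Pi(\rho,\varrho)}\int_{X\times X}c(x,y)\,d\gamma(x,y),$$ and for probability measures $\varphi,\psi$ on $\mathcal{P}(X)$ put $$\mathcal{HW}_1(\varphi,\psi)=\inf_{\eta\in\Pi(\varphi,\psi)}\int_{\mathcal{P}(X)^2}\mathcal{W}_1(\rho,\varrho)\,d\eta(\rho,\varrho),$$ where $\Pi(\cdot,\cdot)$ is the set of couplings of the two measures. Let $\varphi_{\mathcal{S}},\varphi_{\mathcal{T}}$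 be probability measures on $\mathcal{P}(X)$, and let $\mu_{\mathcal{S}}=\int\rho\,d\varphi_{\mathcal{S}}(\rho)$ and $\mu_{\mathcal{T}}=\int\rho\,d\varphi_{\mathcal{T}}(\rho)$ be their mixtures (barycentres). Let $q>0$ and, for $h,h'\in\mathcal{H}_k$, let $l_{h,h'}(x)=|h(x)-h'(x)|^q$, $\epsilon_{\mathcal{S}}(h,h')=\int l_{h,h'}\,d\mu_{\mathcal{S}}$ and $\epsilon_{\mathcal{T}}(h,h')=\int l_{h,h'}\,d\mu_{\mathcal{T}}$. Then for all $(h,h')\in\mathcal{H}_k^2$ such that $l_{h,h'}\in\mathcal{H}_k$ and $\|l_{h,h'}\|_{\mathcal{H}_k}\le 1$, the function $l_{h,h'}$ is integrable with respect to $\mu_{\mathcal{S}}$ and $\mu_{\mathcal{T}}$, $\mathcal{HW}_1(\varphi_{\mathcal{S}},\varphi_{\mathcal{T}})<\infty$, and $$\epsilon_{\mathcal{T}}(h,h')\le\epsilon_{\mathcal{S}}(h,h')+\mathcal{HW}_1(\varphi_{\mathcal{S}},\varphi_{\mathcal{T}}).$$ -/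

import Mathlib

open MeasureTheory
open scoped ENNReal

namespace HierarchicalOT

noncomputable section

/-- `γ` is a transport plan between `μ` and `ν`: a joint law with marginals `μ` and `ν`. -/
def IsTransportPlan {α : Type*} [MeasurableSpace α] (μ ν : ProbabilityMeasure α)
    (γ : ProbabilityMeasure (α × α)) : Prop :=
  (γ : Measure (α × α)).map Prod.fst = (μ : Measure α) ∧
    (γ : Measure (α × α)).map Prod.snd = (ν : Measure α)

/-- The Wasserstein distance of order `p` for the ground distance `c`, with values in `[0, ∞]`:
`(inf_γ ∫ c(x, y) ^ p dγ(x, y)) ^ (1 / p)` over all transport plans `γ`. -/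
def wasserstein {α : Type*} [MeasurableSpace α] (p : ℝ) (c : α → α → ℝ≥0∞)
    (μ ν : ProbabilityMeasure α) : ℝ≥0∞ :=
  (⨅ (γ : ProbabilityMeasure (α × α)) (_ : IsTransportPlan μ ν γ),
    ∫⁻ z, c z.1 z.2 ^ p ∂(γ : Measure (α × α))) ^ (1 / p)

/-- The hierarchical Wasserstein distance of order `p`: the Wasserstein distance on laws of random
probability measures whose ground distance is itself the Wasserstein distance. -/
def hierarchicalWasserstein {α : Type*} [MeasurableSpace α] (p : ℝ) (c : α → α → ℝ≥0∞)
    (Φ Ψ : ProbabilityMeasure (ProbabilityMeasure α)) : ℝ≥0∞ :=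
  wasserstein p (wasserstein p c) Φ Ψ

/-- `μ` is the mixture (barycentre) of `Φ`: `μ = ∫ ρ dΦ(ρ)`, as an identity of measures. -/
def IsMixture {α : Type*} [MeasurableSpace α] (μ : ProbabilityMeasure α)
    (Φ : ProbabilityMeasure (ProbabilityMeasure α)) : Prop :=
  ∀ A : Set α, MeasurableSet A →
    (μ : Measure α) A =
      ∫⁻ ρ, (ρ : Measure α) A ∂(Φ : Measure (ProbabilityMeasure α))

/-- The cost `c(x, y) = ‖φ x - φ y‖` induced by a feature map `φ`. -/
def featureCost {α H : Type*} [NormedAddCommGroup H] (φ : α → H) (x y : α) : ℝ≥0∞ :=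
  ENNReal.ofReal ‖φ x - φ y‖

/-- The loss `x ↦ |f x - f' x| ^ q`. -/
def loss {α : Type*} (q : ℝ) (f f' : α → ℝ) (x : α) : ℝ :=
  |f x - f' x| ^ q

/-- The risk `E_{x ∼ μ} |f x - f' x| ^ q` of a pair of hypotheses. -/
def risk {α : Type*} [MeasurableSpace α] (q : ℝ) (μ : ProbabilityMeasure α)
    (f f' : α → ℝ) : ℝ :=
  ∫ x, loss q f f' x ∂(μ : Measure α)

/-- `f` belongs to the function space `H` and its norm there is at most one. -/
def InUnitBall {α : Type*} (H : Type*) [NormedAddCommGroup H] [InnerProductSpace ℝ H]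
    [RKHS ℝ H α ℝ] (f : α → ℝ) : Prop :=
  ∃ g : H, (∀ x, g x = f x) ∧ ‖g‖ ≤ 1

end

end HierarchicalOT

namespace HierarchicalOT

section Transport

variable {α : Type*} [MeasurableSpace α]

/-! If `f y ≤ f x + c x y`, integrating over any coupling gives `∫ f dν ≤ ∫ f dμ + W₁(μ, ν)`. Thus
`ρ ↦ ∫ f dρ` satisfies the same inequality with cost `W₁`, and the argument repeats on the space of
measures (`lintegral_le_add_wasserstein_one`, used twice). The mixture property turns the iterated
integrals into risks. The loss qualifies as `f`: by the reproducing property and Cauchy–Schwarz, an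
element of the unit ball is 1-Lipschitz for the feature cost. -/

theorem wasserstein_one (c : α → α → ℝ≥0∞) (μ ν : ProbabilityMeasure α) :
    wasserstein 1 c μ ν = ⨅ (γ : ProbabilityMeasure (α × α)) (_ : IsTransportPlan μ ν γ),
      ∫⁻ z, c z.1 z.2 ∂(γ : Measure (α × α)) := by
  simp [wasserstein]

/-- The independent coupling is a transport plan. -/
theorem isTransportPlan_prod (μ ν : ProbabilityMeasure α) :
    IsTransportPlan μ ν ⟨(μ : Measure α).prod (ν : Measure α), inferInstance⟩ := by
  constructor
  · exact measurePreserving_fst.map_eq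
  · exact measurePreserving_snd.map_eq

theorem wasserstein_one_le_of_forall_le {c : α → α → ℝ≥0∞} {C : ℝ≥0∞}
    (hc : ∀ x y, c x y ≤ C) (μ ν : ProbabilityMeasure α) :
    wasserstein 1 c μ ν ≤ C := by
  rw [wasserstein_one]
  refine (iInf₂_le _ (isTransportPlan_prod μ ν)).trans ?_
  refine (lintegral_mono fun z : α × α => hc z.1 z.2).trans ?_
  simp

/-- The easy half of Kantorovich duality. -/
theorem lintegral_le_add_wasserstein_one {c : α → α → ℝ≥0∞} {f : α → ℝ≥0∞}
    (hf : Measurable f) (hfc : ∀ x y, f y ≤ f x + c x y) (μ ν : ProbabilityMeasure α) :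
    ∫⁻ y, f y ∂(ν : Measure α) ≤ ∫⁻ x, f x ∂(μ : Measure α) + wasserstein 1 c μ ν := by
  rw [wasserstein_one]
  simp_rw [ENNReal.add_iInf]
  refine le_iInf₂ fun γ hγ => ?_
  -- `lintegral_add_left` needs only `f` measurable, so `c` may be arbitrary; this permits the cost
  -- `wasserstein 1 c` one level up.
  rw [← hγ.1, ← hγ.2, lintegral_map hf measurable_fst, lintegral_map hf measurable_snd,
    ← lintegral_add_left (f := fun z : α × α => f z.1) (hf.comp measurable_fst)]
  exact lintegral_mono fun z : α × α => hfc z.1 z.2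

theorem IsMixture.lintegral_eq {μ : ProbabilityMeasure α}
    {Φ : ProbabilityMeasure (ProbabilityMeasure α)} (h : IsMixture μ Φ) {f : α → ℝ≥0∞}
    (hf : Measurable f) :
    ∫⁻ x, f x ∂(μ : Measure α) =
      ∫⁻ ρ, ∫⁻ x, f x ∂(ρ : Measure α) ∂(Φ : Measure (ProbabilityMeasure α)) := by
  have hcoe : Measurable fun ρ : ProbabilityMeasure α => (ρ : Measure α) :=
    measurable_subtype_coe
  have hμ : (μ : Measure α) =
      (Φ : Measure (ProbabilityMeasure α)).bind fun ρ => (ρ : Measure α) := by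
    ext A hA
    rw [h A hA, Measure.bind_apply hA hcoe.aemeasurable]
  rw [hμ, Measure.lintegral_bind hcoe.aemeasurable hf.aemeasurable]

theorem IsMixture.lintegral_le_add_hierarchicalWasserstein_one {μ ν : ProbabilityMeasure α}
    {Φ Ψ : ProbabilityMeasure (ProbabilityMeasure α)} (hμ : IsMixture μ Φ) (hν : IsMixture ν Ψ)
    {c : α → α → ℝ≥0∞} {f : α → ℝ≥0∞} (hf : Measurable f)
    (hfc : ∀ x y, f y ≤ f x + c x y) :
    ∫⁻ y, f y ∂(ν : Measure α) ≤
      ∫⁻ x, f x ∂(μ : Measure α) + hierarchicalWasserstein 1 c Φ Ψ := by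
  rw [hμ.lintegral_eq hf, hν.lintegral_eq hf]
  exact lintegral_le_add_wasserstein_one
    ((Measure.measurable_lintegral hf).comp measurable_subtype_coe)
    (lintegral_le_add_wasserstein_one hf hfc) Φ Ψ

end Transport

section ReproducingKernel

variable {α H : Type*} [NormedAddCommGroup H] [InnerProductSpace ℝ H] [CompleteSpace H]
  [RKHS ℝ H α ℝ]

theorem apply_eq_inner_kerFun (g : H) (x : α) : g x = inner ℝ g (RKHS.kerFun H x (1 : ℝ)) := by
  simp

theorem inner_kerFun_kerFun (x y : α) :
    inner ℝ (RKHS.kerFun H x (1 : ℝ)) (RKHS.kerFun H y (1 : ℝ)) = RKHS.kernel H x y (1 : ℝ) := by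
  rw [← RKHS.kerFun_apply, RKHS.kerFun_inner]
  simp

/-- A feature map has the same distances as the canonical feature map. -/
theorem norm_kerFun_sub_kerFun {φ : α → H}
    (hφ : ∀ x y, RKHS.kernel H x y (1 : ℝ) = inner ℝ (φ x) (φ y)) (x y : α) :
    ‖RKHS.kerFun H x (1 : ℝ) - RKHS.kerFun H y (1 : ℝ)‖ = ‖φ x - φ y‖ := by
  -- Both squared distances expand to `k(x,x) - 2k(x,y) + k(y,y)`.
  rw [← sq_eq_sq₀ (norm_nonneg _) (norm_nonneg _), norm_sub_sq_real, norm_sub_sq_real,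
    ← real_inner_self_eq_norm_sq, ← real_inner_self_eq_norm_sq, ← real_inner_self_eq_norm_sq,
    ← real_inner_self_eq_norm_sq]
  simp only [inner_kerFun_kerFun, hφ]

theorem abs_apply_sub_apply_le {φ : α → H}
    (hφ : ∀ x y, RKHS.kernel H x y (1 : ℝ) = inner ℝ (φ x) (φ y)) (g : H) (x y : α) :
    |g x - g y| ≤ ‖g‖ * ‖φ x - φ y‖ := by
  rw [apply_eq_inner_kerFun, apply_eq_inner_kerFun, ← inner_sub_right,
    ← norm_kerFun_sub_kerFun hφ]
  exact abs_real_inner_le_norm _ _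

theorem norm_le_sqrt_of_kernel_le {φ : α → H} {K : ℝ}
    (hφ : ∀ x y, RKHS.kernel H x y (1 : ℝ) = inner ℝ (φ x) (φ y))
    (hK : ∀ x, RKHS.kernel H x x (1 : ℝ) ≤ K) (x : α) : ‖φ x‖ ≤ √K := by
  apply Real.le_sqrt_of_sq_le
  rw [← real_inner_self_eq_norm_sq, ← hφ]
  exact hK x

theorem abs_apply_le_sqrt {K : ℝ} (hK : ∀ x, RKHS.kernel H x x (1 : ℝ) ≤ K) (g : H) (x : α) :
    |g x| ≤ ‖g‖ * √K := by
  rw [apply_eq_inner_kerFun]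
  refine (abs_real_inner_le_norm _ _).trans ?_
  gcongr
  exact norm_le_sqrt_of_kernel_le (fun x y => (inner_kerFun_kerFun x y).symm) hK x

/-- The members of a reproducing kernel Hilbert space with measurable kernel sections are
measurable. -/
theorem measurable_of_measurable_kernel [MeasurableSpace α]
    (hk : ∀ y, Measurable fun x => RKHS.kernel H x y (1 : ℝ)) (g : H) : Measurable g := by
  have hg : g ∈ (Submodule.span ℝ
      {RKHS.kerFun H y v | (y : α) (v : ℝ)}).topologicalClosure := by
    rw [RKHS.kerFun_dense]
    trivial
  rw [← SetLike.mem_coe, Submodule.topologicalClosure_coe] at hg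
  obtain ⟨u, hu, hlim⟩ := mem_closure_iff_seq_limit.1 hg
  -- Evaluations are continuous, so norm convergence of combinations of kernel sections implies
  -- pointwise convergence.
  refine measurable_of_tendsto_metrizable (f := fun n => ⇑(u n)) (fun n => ?_)
    (tendsto_pi_nhds.2 fun x => ((RKHS.continuous_eval x).tendsto g).comp hlim)
  refine Submodule.span_induction (p := fun (f : H) _ => Measurable f) ?_ ?_ ?_ ?_ (hu n)
  · rintro _ ⟨y, v, rfl⟩
    have : ⇑(RKHS.kerFun H y v) = fun x => v * RKHS.kernel H x y (1 : ℝ) := by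
      ext x
      rw [RKHS.kerFun_apply, ← smul_eq_mul, ← map_smul, smul_eq_mul, mul_one]
    rw [this]
    exact (hk y).const_mul v
  · rw [RKHS.coe_zero]
    exact measurable_const
  · intro f f' _ _ hf hf'
    rw [RKHS.coe_add]
    exact hf.add hf'
  · intro a f _ hf
    rw [RKHS.coe_smul]
    exact hf.const_smul a

end ReproducingKernel

theorem loss_nonneg {α : Type*} (q : ℝ) (f f' : α → ℝ) (x : α) : 0 ≤ loss q f f' x :=
  Real.rpow_nonneg (abs_nonneg _) q

theorem featureCost_le {α H : Type*} [NormedAddCommGroup H] {φ : α → H} {C : ℝ}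
    (hφ : ∀ x, ‖φ x‖ ≤ C) (x y : α) : featureCost φ x y ≤ ENNReal.ofReal (C + C) :=
  ENNReal.ofReal_le_ofReal ((norm_sub_le _ _).trans (add_le_add (hφ x) (hφ y)))

end HierarchicalOT

theorem mainTheorem6 {d : ℕ} (X : Set (EuclideanSpace ℝ (Fin d))) (hX : IsCompact X)
    {H : Type*} [NormedAddCommGroup H] [InnerProductSpace ℝ H] [CompleteSpace H]
    [RKHS ℝ H X ℝ]
    (k : X → X → ℝ) (hk : ∀ x y, RKHS.kernel H x y (1 : ℝ) = k x y)
    (hk_meas : Measurable (fun z : X × X => k z.1 z.2))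
    (K : ℝ) (hK : ∀ x y, k x y ≤ K)
    (φ : X → H) (hφ : ∀ x y, k x y = inner ℝ (φ x) (φ y))
    (q : ℝ) (hq : 0 < q)
    (μS μT : ProbabilityMeasure X)
    (φS φT : ProbabilityMeasure (ProbabilityMeasure X))
    (hS : HierarchicalOT.IsMixture μS φS) (hT : HierarchicalOT.IsMixture μT φT) :
    ∀ h h' : H, HierarchicalOT.InUnitBall H (HierarchicalOT.loss q h h') →
      Integrable (HierarchicalOT.loss q h h') (μS : Measure X) ∧
      Integrable (HierarchicalOT.loss q h h') (μT : Measure X) ∧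
      HierarchicalOT.hierarchicalWasserstein 1 (HierarchicalOT.featureCost φ) φS φT ≠ ∞ ∧
      HierarchicalOT.risk q μT h h' ≤ HierarchicalOT.risk q μS h h' +
        (HierarchicalOT.hierarchicalWasserstein 1
          (HierarchicalOT.featureCost φ) φS φT).toReal := by
  intro h h' ⟨g, hgl, hg⟩
  have hkφ : ∀ x y, RKHS.kernel H x y (1 : ℝ) = inner ℝ (φ x) (φ y) :=
    fun x y => (hk x y).trans (hφ x y)
  have hkK : ∀ x, RKHS.kernel H x x (1 : ℝ) ≤ K := fun x => (hk x x).trans_le (hK x x)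
  have hl : HierarchicalOT.loss q h h' = g := funext fun x => (hgl x).symm
  have hl0 : ∀ x, 0 ≤ g x := fun x => (hgl x).symm ▸ HierarchicalOT.loss_nonneg q h h' x
  have hmeas : Measurable g := HierarchicalOT.measurable_of_measurable_kernel
    (fun y => by
      simp only [hk]
      exact hk_meas.comp (measurable_id.prodMk measurable_const)) g
  have hint : ∀ μ : ProbabilityMeasure X, Integrable g (μ : Measure X) := fun μ =>
    Integrable.of_bound hmeas.aestronglyMeasurable (‖g‖ * √K)
      (Filter.Eventually.of_forall fun x => HierarchicalOT.abs_apply_le_sqrt hkK g x)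
  have hfin : HierarchicalOT.hierarchicalWasserstein 1
      (HierarchicalOT.featureCost φ) φS φT ≠ ∞ :=
    ne_top_of_le_ne_top ENNReal.ofReal_ne_top <|
      HierarchicalOT.wasserstein_one_le_of_forall_le
        (HierarchicalOT.wasserstein_one_le_of_forall_le
          (HierarchicalOT.featureCost_le (HierarchicalOT.norm_le_sqrt_of_kernel_le hkφ hkK))) φS φT
  have hlip : ∀ x y, ENNReal.ofReal (g y) ≤
      ENNReal.ofReal (g x) + HierarchicalOT.featureCost φ x y := fun x y => by
    rw [HierarchicalOT.featureCost, ← ENNReal.ofReal_add (hl0 x) (norm_nonneg _)]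
    refine ENNReal.ofReal_le_ofReal ?_
    have h1 := HierarchicalOT.abs_apply_sub_apply_le hkφ g x y
    have h2 := mul_le_of_le_one_left (norm_nonneg (φ x - φ y)) hg
    linarith [neg_abs_le (g x - g y)]
  have key := hS.lintegral_le_add_hierarchicalWasserstein_one hT hmeas.ennreal_ofReal hlip
  rw [hl]
  refine ⟨hint μS, hint μT, hfin, ?_⟩
  rw [HierarchicalOT.risk, HierarchicalOT.risk, hl]
  -- Nonnegativity, integrability and `hfin` transfer `key` from `[0, ∞]` to the reals.
  rw [← ofReal_integral_eq_lintegral_ofReal (hint μT) (Filter.Eventually.of_forall hl0),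
    ← ofReal_integral_eq_lintegral_ofReal (hint μS) (Filter.Eventually.of_forall hl0),
    ← ENNReal.ofReal_toReal hfin,
    ← ENNReal.ofReal_add (integral_nonneg hl0) ENNReal.toReal_nonneg] at key
  exact (ENNReal.ofReal_le_ofReal_iff
    (add_nonneg (integral_nonneg hl0) ENNReal.toReal_nonneg)).1 key
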